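/- All vector spaces are real. A *Banach sequence lattice* is a vector space $Y\subset\mathbb R^{\mathbb N}$ with a complete norm $\|\cdot\|_Y$, containing every canonical sequence $e_k$, such that $f\in\mathbb R^{\mathbb N}$, $g\in Y$ and $|f|\le|g|$ pointwise imply $f\in Y$ and $\|f\|_Y\le\|g\|_Y$; finite sequences $(t_1,\dots,t_n)$ are identified with $(t_1,\dots,t_n,0,0,\dots)\in Y$. For $n\in\mathbb N$ let $\mathcal H_n$ be the space of continuous $h:\mathbb R^n\to\mathbb R$ with $h(\lambda t)=\lambda h(t)$ for all $\lambda\ge0$. For a Banach lattice $X$ and $x=(x_1,\dots,x_n)\in X^n$ let $\tau_{n,x}:\mathcal H_n\to X$ be Krivine's functional calculus, i.e. the unique linear map with $\tau_{n,x}(\pi_j)=x_j$ for every coordinate projection $\pi_j$ and $\tau_{n,x}(h_1\vee h_2)=\tau_{n,x}(h_1)\vee\tau_{n,x}(h_2)$, and put $\|(x_1,\dots,x_n)\|_{X^n,Y,\tau}:=\big\|\tau_{n,x}\big((t_1,\dots,t_n)\mapsto\|(t_1,\dots,t_n)\|_Y\big)\big\|_X$. Let $E$ be a Banach space. A linear operator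 $T:E\to X$ is *$Y$-convex* if there is $C>0$ with $$\|(Tw_1,\dots,Tw_n)\|_{X^n,Y,\tau}\le C\,\|(\|w_1\|_E,\dots,\|w_n\|_E)\|_Y\qquad\text{for all } n\in\mathbb N,\ w_1,\dots,w_n\in E,$$ and a linear operator $S:X\to E$ is *$Y$-concave* if there is $K>0$ with $$\|(\|Sx_1\|_E,\dots,\|Sx_n\|_E)\|_Y\le K\,\|(x_1,\dots,x_n)\|_{X^n,Y,\tau}\qquad\text{for all } n\in\mathbb N,\ x_1,\dots,x_n\in X.$$ A Banach lattice is called $Y$-convex (resp. $Y$-concave) if its identity operator is. A *lattice isomorphism* between Banach lattices is a bijective bounded linear operator $H$ with continuous inverse such that $H(x\vee y)=Hx\vee Hy$ for all $x,y$. **Corollary.** Let $Y$ be a Banach sequence lattice, $E$ a Banach space, and $X,W$ Banach lattices. 1. If $H_1:X\to W$ is a lattice isomorphism, then for every bounded linear $T:E\to X$: $H_1\circ T$ is $Y$-convex if and only if $T$ is $Y$-convex. 2. If $H_2:W\to X$ is a lattice isomorphism, then for every bounded linear $S:X\to E$: $S\circ H_2$ is $Y$-concave if and only if $S$ is $Y$-concave.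 3. If $H:X\to W$ is a lattice isomorphism, then $X$ is $Y$-convex if and only if $W$ is $Y$-convex, and $X$ is $Y$-concave if and only if $W$ is $Y$-concave. -/

import Mathlib

open Set Filter Topology
open scoped Pointwise

namespace YConvexity

/-! ### Krivine's functional calculus -/

/-- `𝓗_n`: the continuous functions `ℝⁿ → ℝ` that are homogeneous of degree one. -/
def HomFun (n : ℕ) : Submodule ℝ ((Fin n → ℝ) → ℝ) where
  carrier := {h | Continuous h ∧ ∀ c : ℝ, 0 ≤ c → ∀ t, h (c • t) = c * h t}
  zero_mem' := ⟨continuous_const, by simp⟩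
  add_mem' := by
    rintro f g ⟨hf, hf'⟩ ⟨hg, hg'⟩
    refine ⟨hf.add hg, fun c hc t => ?_⟩
    simp [hf' c hc t, hg' c hc t, mul_add]
  smul_mem' := by
    rintro a f ⟨hf, hf'⟩
    refine ⟨hf.const_smul a, fun c hc t => ?_⟩
    simp [hf' c hc t, mul_left_comm]

/-- The coordinate projection `π_{n,j}` as an element of `𝓗_n`. -/
def HomFun.proj {n : ℕ} (j : Fin n) : HomFun n :=
  ⟨fun t => t j, continuous_apply j, fun c _ t => by simp⟩

/-- The pointwise maximum `h₁ ∨ h₂` in `𝓗_n`. -/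
def HomFun.sup {n : ℕ} (h₁ h₂ : HomFun n) : HomFun n :=
  ⟨fun t => max (h₁.1 t) (h₂.1 t), h₁.2.1.max h₂.2.1, fun c hc t => by
    simp only [h₁.2.2 c hc, h₂.2.2 c hc, mul_max_of_nonneg _ _ hc]⟩

/-- `τ : 𝓗_n → X` is a Krivine functional calculus for `x = (x₁, …, xₙ)`: a linear map that
sends `π_{n,j}` to `x_j` and preserves binary suprema. -/
structure IsKrivine {X : Type*} [AddCommGroup X] [Module ℝ X] [Lattice X] {n : ℕ}
    (x : Fin n → X) (τ : HomFun n →ₗ[ℝ] X) : Prop where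
  map_proj : ∀ j, τ (HomFun.proj j) = x j
  map_sup : ∀ h₁ h₂, τ (HomFun.sup h₁ h₂) = τ h₁ ⊔ τ h₂

/-- The supremum `⋁_{a ∈ A} (a₁ x₁ + ⋯ + aₙ xₙ)` over a finite non-empty `A ⊆ ℝⁿ`. -/
def supLin {R : Type*} [AddCommGroup R] [Module ℝ R] [Lattice R] {n : ℕ}
    (A : Finset (Fin n → ℝ)) (hA : A.Nonempty) (x : Fin n → R) : R :=
  A.sup' hA fun a => ∑ j, a j • x j

theorem supLin_le_iff {R : Type*} [AddCommGroup R] [Module ℝ R] [Lattice R] {n : ℕ}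
    {A : Finset (Fin n → ℝ)} (hA : A.Nonempty) (x : Fin n → R) (z : R) :
    supLin A hA x ≤ z ↔ ∀ a ∈ A, ∑ j, a j • x j ≤ z := by
  simp [supLin]

theorem le_supLin {R : Type*} [AddCommGroup R] [Module ℝ R] [Lattice R] {n : ℕ}
    {A : Finset (Fin n → ℝ)} (hA : A.Nonempty) (x : Fin n → R) {a : Fin n → ℝ} (ha : a ∈ A) :
    ∑ j, a j • x j ≤ supLin A hA x :=
  (supLin_le_iff hA x _).1 le_rfl a ha

theorem supLin_singleton {R : Type*} [AddCommGroup R] [Module ℝ R] [Lattice R] {n : ℕ}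
    (a : Fin n → ℝ) (x : Fin n → R) :
    supLin {a} (Finset.singleton_nonempty a) x = ∑ j, a j • x j := by
  simp [supLin]

theorem supLin_union {R : Type*} [AddCommGroup R] [Module ℝ R] [Lattice R] {n : ℕ}
    {A B : Finset (Fin n → ℝ)} (hA : A.Nonempty) (hB : B.Nonempty) (hAB : (A ∪ B).Nonempty)
    (x : Fin n → R) : supLin (A ∪ B) hAB x = supLin A hA x ⊔ supLin B hB x :=
  Finset.sup'_union hA hB _

theorem supLin_add {R : Type*} [AddCommGroup R] [Module ℝ R] [Lattice R] [IsOrderedAddMonoid R]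
    {n : ℕ} {A B : Finset (Fin n → ℝ)} (hA : A.Nonempty) (hB : B.Nonempty)
    (hAB : (A + B).Nonempty) (x : Fin n → R) :
    supLin (A + B) hAB x = supLin A hA x + supLin B hB x := by
  refine eq_of_forall_ge_iff fun z => ?_
  rw [← le_sub_iff_add_le, supLin_le_iff, supLin_le_iff]
  have key : ∀ a b : Fin n → ℝ, ∑ j, (a + b) j • x j = ∑ j, a j • x j + ∑ j, b j • x j := by
    intro a b; simp [add_smul, Finset.sum_add_distrib]
  constructor
  · intro h a ha
    rw [le_sub_iff_add_le, ← le_sub_iff_add_le', supLin_le_iff]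
    intro b hb
    rw [le_sub_iff_add_le', ← key]
    exact h _ (Finset.add_mem_add ha hb)
  · intro h c hc
    obtain ⟨a, ha, b, hb, rfl⟩ := Finset.mem_add.1 hc
    have h1 := h a ha
    rw [le_sub_iff_add_le, ← le_sub_iff_add_le', supLin_le_iff] at h1
    rw [key, ← le_sub_iff_add_le']
    exact h1 b hb

theorem supLin_smul {R : Type*} [AddCommGroup R] [Module ℝ R] [Lattice R] [IsOrderedAddMonoid R]
    [IsOrderedModule ℝ R] {n : ℕ} {A : Finset (Fin n → ℝ)} (hA : A.Nonempty) {c : ℝ} (hc : 0 < c)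
    (hcA : (c • A).Nonempty) (x : Fin n → R) :
    supLin (c • A) hcA x = c • supLin A hA x := by
  refine eq_of_forall_ge_iff fun z => ?_
  rw [← le_inv_smul_iff_of_pos hc, supLin_le_iff, supLin_le_iff]
  have key : ∀ a : Fin n → ℝ, ∑ j, (c • a) j • x j = c • ∑ j, a j • x j := by
    intro a; simp [Finset.smul_sum, mul_smul]
  constructor
  · intro h a ha
    rw [le_inv_smul_iff_of_pos hc, ← key]
    exact h _ (Finset.smul_mem_smul_finset ha)
  · intro h b hb
    obtain ⟨a, ha, rfl⟩ := Finset.mem_smul_finset.1 hb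
    rw [key, ← le_inv_smul_iff_of_pos hc]
    exact h a ha

/-- An inequality between suprema of linear forms that holds in `ℝ` holds in every Riesz space. -/
theorem supLin_mono {R : Type*} [AddCommGroup R] [Module ℝ R] [Lattice R] [IsOrderedAddMonoid R]
    [IsOrderedModule ℝ R] {n : ℕ} {A B : Finset (Fin n → ℝ)} (hA : A.Nonempty) (hB : B.Nonempty)
    (h : ∀ t : Fin n → ℝ, supLin A hA t ≤ supLin B hB t) (x : Fin n → R) :
    supLin A hA x ≤ supLin B hB x := by
  rw [supLin_le_iff]
  intro a ha
  have hmem : a ∈ convexHull ℝ (B : Set (Fin n → ℝ)) := by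
    by_contra hcon
    obtain ⟨f, u, hf, hu⟩ := geometric_hahn_banach_closed_point (convex_convexHull ℝ _)
      (B.finite_toSet.isClosed_convexHull ℝ) hcon
    have hfe : ∀ c : Fin n → ℝ, ∑ j, c j • f (Pi.single j 1) = f c := by
      intro c
      conv_rhs => rw [pi_eq_sum_univ' c]
      simp [map_sum]
    have h1 := h fun j => f (Pi.single j 1)
    have h2 : supLin B hB (fun j => f (Pi.single j 1)) ≤ u := by
      rw [supLin_le_iff]
      intro b hb
      rw [hfe]
      exact (hf b (subset_convexHull ℝ _ hb)).le
    have h3 := le_supLin hA (fun j => f (Pi.single j 1)) ha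
    rw [hfe] at h3
    linarith
  have hconv : Convex ℝ {c : Fin n → ℝ | ∑ j, c j • x j ≤ supLin B hB x} := by
    intro c hc d hd p q hp hq hpq
    have e : ∑ j, (p • c + q • d) j • x j = p • ∑ j, c j • x j + q • ∑ j, d j • x j := by
      simp [add_smul, mul_smul, Finset.sum_add_distrib, Finset.smul_sum]
    have e2 : supLin B hB x = p • supLin B hB x + q • supLin B hB x := by
      rw [← add_smul, hpq, one_smul]
    simp only [mem_ofPred_eq] at hc hd ⊢
    rw [e, e2]
    exact add_le_add (smul_le_smul_of_nonneg_left hc hp) (smul_le_smul_of_nonneg_left hd hq)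
  exact convexHull_min (fun b hb => le_supLin hB x hb) hconv hmem

/-- The unit sphere of the supremum norm on `ℝⁿ`. -/
abbrev CubeSphere (n : ℕ) : Type := Metric.sphere (0 : Fin n → ℝ) 1

/-- The `j`-th coordinate, restricted to the sphere. -/
def sphereProj {n : ℕ} (j : Fin n) : C(CubeSphere n, ℝ) :=
  ⟨fun s => s.1 j, (continuous_apply j).comp continuous_subtype_val⟩

/-- The pairs `(f, y)` of a difference `f` of two finite suprema of linear forms, restricted to the
unit sphere of the supremum norm, and its counterpart `y` formed with `x₁, …, xₙ`. -/
def krivineGraph {X : Type*} [NormedAddCommGroup X] [NormedSpace ℝ X] [Lattice X]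
    [IsOrderedAddMonoid X] [IsOrderedModule ℝ X] {n : ℕ} (x : Fin n → X) :
    Submodule ℝ (C(CubeSphere n, ℝ) × X) where
  carrier := {p | ∃ (A B : Finset (Fin n → ℝ)) (hA : A.Nonempty) (hB : B.Nonempty),
    (∀ s, p.1 s = supLin A hA s.1 - supLin B hB s.1) ∧ p.2 = supLin A hA x - supLin B hB x}
  zero_mem' := ⟨{0}, {0}, Finset.singleton_nonempty 0, Finset.singleton_nonempty 0,
    by simp, by simp⟩
  add_mem' := by
    rintro p q ⟨A, B, hA, hB, h1, h2⟩ ⟨C, D, hC, hD, h3, h4⟩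
    refine ⟨A + C, B + D, hA.add hC, hB.add hD, fun s => ?_, ?_⟩
    · simp only [supLin_add hA hC, supLin_add hB hD, Prod.fst_add, ContinuousMap.add_apply, h1, h3]
      abel
    · simp only [supLin_add hA hC, supLin_add hB hD, Prod.snd_add, h2, h4]
      abel
  smul_mem' := by
    rintro c p ⟨A, B, hA, hB, h1, h2⟩
    rcases lt_trichotomy c 0 with hc | rfl | hc
    · have hc' : 0 < -c := by linarith
      refine ⟨(-c) • B, (-c) • A, hB.smul_finset, hA.smul_finset, fun s => ?_, ?_⟩
      · simp only [supLin_smul hA hc', supLin_smul hB hc', Prod.smul_fst, ContinuousMap.smul_apply,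
          h1, smul_eq_mul]
        ring
      · simp only [supLin_smul hA hc', supLin_smul hB hc', Prod.smul_snd, h2, neg_smul, smul_sub]
        abel
    · exact ⟨{0}, {0}, Finset.singleton_nonempty 0, Finset.singleton_nonempty 0, by simp, by simp⟩
    · refine ⟨c • A, c • B, hA.smul_finset, hB.smul_finset, fun s => ?_, ?_⟩
      · simp only [supLin_smul hA hc, supLin_smul hB hc, Prod.smul_fst, ContinuousMap.smul_apply,
          h1, smul_eq_mul]
        ring
      · simp only [supLin_smul hA hc, supLin_smul hB hc, Prod.smul_snd, h2, smul_sub]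

theorem sub_sup_sub_eq {R : Type*} [AddCommGroup R] [Lattice R] [IsOrderedAddMonoid R]
    (a b c d : R) : (a - b) ⊔ (c - d) = ((a + d) ⊔ (c + b)) - (b + d) := by
  rw [sup_sub]
  congr 1 <;> abel

theorem krivineGraph_sup {X : Type*} [NormedAddCommGroup X] [NormedSpace ℝ X] [Lattice X]
    [IsOrderedAddMonoid X] [IsOrderedModule ℝ X] {n : ℕ} (x : Fin n → X)
    {p q : C(CubeSphere n, ℝ) × X}
    (hp : p ∈ krivineGraph x) (hq : q ∈ krivineGraph x) : p ⊔ q ∈ krivineGraph x := by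
  obtain ⟨A, B, hA, hB, h1, h2⟩ := hp
  obtain ⟨C, D, hC, hD, h3, h4⟩ := hq
  refine ⟨(A + D) ∪ (C + B), B + D, (hA.add hD).mono Finset.subset_union_left, hB.add hD,
    fun s => ?_, ?_⟩
  · rw [supLin_union (hA.add hD) (hC.add hB), supLin_add hA hD, supLin_add hC hB,
      supLin_add hB hD, ← sub_sup_sub_eq, ← h1, ← h3]
    rfl
  · rw [supLin_union (hA.add hD) (hC.add hB), supLin_add hA hD, supLin_add hC hB,
      supLin_add hB hD, ← sub_sup_sub_eq, ← h2, ← h4]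
    rfl

theorem krivineGraph_proj {X : Type*} [NormedAddCommGroup X] [NormedSpace ℝ X] [Lattice X]
    [IsOrderedAddMonoid X] [IsOrderedModule ℝ X] {n : ℕ} (x : Fin n → X) (j : Fin n) :
    ((sphereProj j, x j) : C(CubeSphere n, ℝ) × X) ∈
      krivineGraph x := by
  refine ⟨{Pi.single j 1}, {0}, Finset.singleton_nonempty _, Finset.singleton_nonempty 0, ?_, ?_⟩
  · intro s; simp [supLin_singleton, Pi.single_apply, sphereProj]
  · simp [supLin_singleton, Pi.single_apply]

theorem supLin_real_smul {n : ℕ} {A : Finset (Fin n → ℝ)} (hA : A.Nonempty) {c : ℝ} (hc : 0 ≤ c)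
    (t : Fin n → ℝ) : supLin A hA (c • t) = c * supLin A hA t := by
  rcases hc.eq_or_lt with rfl | hc
  · simp [supLin]
  · refine eq_of_forall_ge_iff fun z => ?_
    rw [← le_inv_mul_iff₀ hc, supLin_le_iff, supLin_le_iff]
    refine forall₂_congr fun a _ => ?_
    rw [le_inv_mul_iff₀ hc, Finset.mul_sum]
    simp [mul_left_comm]

theorem krivineGraph_bound {X : Type*} [NormedAddCommGroup X] [NormedSpace ℝ X] [Lattice X]
    [HasSolidNorm X] [IsOrderedAddMonoid X] [IsOrderedModule ℝ X] {n : ℕ} (x : Fin n → X) :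
    ∃ K : ℝ, 0 ≤ K ∧ ∀ p ∈ krivineGraph x, ‖p.2‖ ≤ K * ‖p.1‖ := by
  classical
  let C : Finset (Fin n → ℝ) := insert 0
    (Finset.univ.image (fun j => Pi.single j 1) ∪ Finset.univ.image (fun j => Pi.single j (-1)))
  have hC : C.Nonempty := Finset.insert_nonempty _ _
  have hCt : ∀ t : Fin n → ℝ, ‖t‖ ≤ supLin C hC t := by
    intro t
    have h0 : 0 ≤ supLin C hC t := by
      simpa using le_supLin hC t (a := 0) (by simp [C])
    refine (pi_norm_le_iff_of_nonneg h0).2 fun j => abs_le'.2 ⟨?_, ?_⟩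
    · simpa [Pi.single_apply] using le_supLin hC t (a := Pi.single j 1) (by simp [C])
    · simpa [Pi.single_apply] using le_supLin hC t (a := Pi.single j (-1)) (by simp [C])
  refine ⟨‖supLin C hC x‖, norm_nonneg _, ?_⟩
  have half : ∀ (A B : Finset (Fin n → ℝ)) (hA : A.Nonempty) (hB : B.Nonempty) (c : ℝ), 0 < c →
      (∀ s : CubeSphere n, supLin A hA s.1 - supLin B hB s.1 ≤ c) →
      supLin A hA x - supLin B hB x ≤ c • supLin C hC x := by
    intro A B hA hB c hc h
    rw [sub_le_iff_le_add', ← supLin_smul hC hc (hC.smul_finset),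
      ← supLin_add hB (hC.smul_finset) (hB.add (hC.smul_finset))]
    refine supLin_mono hA _ (fun t => ?_) x
    rw [supLin_add hB (hC.smul_finset), supLin_smul hC hc]
    rcases eq_or_ne t 0 with rfl | ht
    · simp [supLin]
    · have htn : 0 < ‖t‖ := norm_pos_iff.2 ht
      have hs := h ⟨‖t‖⁻¹ • t, by simp [norm_smul, htn.ne']⟩
      have ht' : t = ‖t‖ • (‖t‖⁻¹ • t) := by rw [smul_smul, mul_inv_cancel₀ htn.ne', one_smul]
      have e1 := supLin_real_smul hA htn.le (‖t‖⁻¹ • t)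
      have e2 := supLin_real_smul hB htn.le (‖t‖⁻¹ • t)
      rw [← ht'] at e1 e2
      have h3 := mul_le_mul_of_nonneg_left hs htn.le
      have h4 := mul_le_mul_of_nonneg_left (hCt t) hc.le
      simp only [smul_eq_mul] at *
      nlinarith
  rintro p ⟨A, B, hA, hB, h1, h2⟩
  have main : ∀ c : ℝ, ‖p.1‖ < c → ‖p.2‖ ≤ ‖supLin C hC x‖ * c := by
    intro c hcp
    have hc : 0 < c := (norm_nonneg _).trans_lt hcp
    have hb : ∀ s : CubeSphere n, |supLin A hA s.1 - supLin B hB s.1| ≤ c := fun s => by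
      rw [← h1]; exact (p.1.norm_coe_le_norm s).trans hcp.le
    have i1 := half A B hA hB c hc fun s => (abs_le'.1 (hb s)).1
    have i2 := half B A hB hA c hc fun s => by have := (abs_le'.1 (hb s)).2; linarith
    have i3 : |p.2| ≤ |c • supLin C hC x| := by
      refine le_trans ?_ (le_abs_self _)
      rw [h2]
      exact abs_le'.2 ⟨i1, by rwa [neg_sub]⟩
    refine (norm_le_norm_of_abs_le_abs i3).trans ?_
    rw [norm_smul, Real.norm_of_nonneg hc.le, mul_comm]
  refine le_of_forall_gt_imp_ge_of_dense fun d hd => ?_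
  by_contra hlt
  push Not at hlt
  have hcont : Tendsto (fun c : ℝ => ‖supLin C hC x‖ * c) (𝓝[>] ‖p.1‖)
      (𝓝 (‖supLin C hC x‖ * ‖p.1‖)) :=
    ((continuous_const.mul continuous_id).tendsto _).mono_left nhdsWithin_le_nhds
  have := ge_of_tendsto hcont (by filter_upwards [self_mem_nhdsWithin] with c hc using main c hc)
  linarith

theorem krivineGraph_dense {X : Type*} [NormedAddCommGroup X] [NormedSpace ℝ X] [Lattice X]
    [IsOrderedAddMonoid X] [IsOrderedModule ℝ X] {n : ℕ} (x : Fin n → X) :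
    closure (Prod.fst '' (krivineGraph x : Set (C(CubeSphere n, ℝ) × X))) = univ := by
  set D : Set C(CubeSphere n, ℝ) :=
    Prod.fst '' (krivineGraph x : Set (C(CubeSphere n, ℝ) × X)) with hD
  have hsup : ∀ f ∈ D, ∀ g ∈ D,
      f ⊔ g ∈ D := by
    rintro _ ⟨p, hp, rfl⟩ _ ⟨q, hq, rfl⟩
    exact ⟨p ⊔ q, krivineGraph_sup x hp hq, rfl⟩
  have hadd : ∀ f ∈ D, ∀ g ∈ D,
      f + g ∈ D := by
    rintro _ ⟨p, hp, rfl⟩ _ ⟨q, hq, rfl⟩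
    exact ⟨p + q, add_mem hp hq, rfl⟩
  have hsmul : ∀ (c : ℝ), ∀ f ∈ D,
      c • f ∈ D := by
    rintro c _ ⟨p, hp, rfl⟩
    exact ⟨c • p, (krivineGraph x).smul_mem c hp, rfl⟩
  have hproj : ∀ j, sphereProj j ∈
      D := fun j => ⟨_, krivineGraph_proj x j, rfl⟩
  refine ContinuousMap.sublattice_closure_eq_top _ ⟨0, 0, zero_mem _, rfl⟩ ?_ hsup ?_
  · intro f hf g hg
    have e : f ⊓ g = (-1 : ℝ) • ((-1 : ℝ) • f ⊔ (-1 : ℝ) • g) := by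
      simp [neg_sup]
    rw [e]
    exact hsmul _ _ (hsup _ (hsmul _ _ hf) _ (hsmul _ _ hg))
  · intro v s t
    have hs : ‖s.1‖ = 1 := by simp
    have ht : ‖t.1‖ = 1 := by simp
    obtain ⟨j, hj⟩ : ∃ j, s.1 j ≠ 0 := by
      by_contra hcon
      push Not at hcon
      have : s.1 = 0 := funext hcon
      simp [this] at hs
    by_cases hst : ∃ i, s.1 j * t.1 i ≠ s.1 i * t.1 j
    · obtain ⟨i, hi⟩ := hst
      have hd : s.1 j * t.1 i - s.1 i * t.1 j ≠ 0 := sub_ne_zero.2 hi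
      refine ⟨_, hadd _ (hsmul ((v s * t.1 i - v t * s.1 i) /
        (s.1 j * t.1 i - s.1 i * t.1 j)) _ (hproj j)) _
        (hsmul ((s.1 j * v t - t.1 j * v s) / (s.1 j * t.1 i - s.1 i * t.1 j)) _ (hproj i)), ?_, ?_⟩
      · simp only [ContinuousMap.add_apply, ContinuousMap.smul_apply, sphereProj, ContinuousMap.coe_mk,
          smul_eq_mul]
        rw [div_mul_eq_mul_div, div_mul_eq_mul_div, ← add_div, div_eq_iff hd]
        ring
      · simp only [ContinuousMap.add_apply, ContinuousMap.smul_apply, sphereProj, ContinuousMap.coe_mk,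
          smul_eq_mul]
        rw [div_mul_eq_mul_div, div_mul_eq_mul_div, ← add_div, div_eq_iff hd]
        ring
    · push Not at hst
      have hts : t.1 = (t.1 j / s.1 j) • s.1 := by
        funext i
        simp only [Pi.smul_apply, smul_eq_mul]
        field_simp
        linarith [hst i]
      have hc : |t.1 j / s.1 j| = 1 := by
        have := congrArg norm hts
        rwa [norm_smul, hs, ht, mul_one, Real.norm_eq_abs, eq_comm] at this
      rcases (abs_eq zero_le_one).1 hc with h1 | h1
      · have : t = s := Subtype.ext (by rw [hts, h1, one_smul])
        subst this
        refine ⟨_, hsmul (v t / t.1 j) _ (hproj j), ?_, ?_⟩ <;>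
          simp [sphereProj, div_mul_cancel₀ _ hj]
      · have htj : t.1 j = -s.1 j := by
          field_simp at h1
          linarith
        have habs : |s.1 j| ≠ 0 := abs_ne_zero.2 hj
        refine ⟨_, hadd _ (hsmul ((v s + v t) / (2 * |s.1 j|)) _
          (hsup _ (hproj j) _ (hsmul (-1) _ (hproj j)))) _
          (hsmul ((v s - v t) / (2 * s.1 j)) _ (hproj j)), ?_, ?_⟩
        · simp only [ContinuousMap.add_apply, ContinuousMap.smul_apply, sphereProj, ContinuousMap.coe_mk,
            smul_eq_mul, ContinuousMap.sup_apply, neg_one_mul]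
          change _ * |s.1 j| + _ = _
          field_simp
          ring
        · simp only [ContinuousMap.add_apply, ContinuousMap.smul_apply, sphereProj, ContinuousMap.coe_mk,
            smul_eq_mul, ContinuousMap.sup_apply, neg_one_mul, htj, neg_neg]
          rw [sup_comm]
          change _ * |s.1 j| + _ = _
          field_simp
          ring

/-- Restriction of a homogeneous function to the sphere. -/
def HomFun.restrict (n : ℕ) : HomFun n →ₗ[ℝ] C(CubeSphere n, ℝ) where
  toFun h := ⟨fun s => h.1 s.1, h.2.1.comp continuous_subtype_val⟩
  map_add' _ _ := rfl
  map_smul' _ _ := rfl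

/-- The supremum norm on `ℝⁿ` as an element of `𝓗_n`. -/
def HomFun.supNorm (n : ℕ) : HomFun n :=
  ⟨fun t => ‖t‖, continuous_norm, fun c hc t => by
    simp only [norm_smul, Real.norm_of_nonneg hc]⟩

theorem IsKrivine.exists {X : Type*} [NormedAddCommGroup X] [NormedSpace ℝ X] [CompleteSpace X]
    [Lattice X] [HasSolidNorm X] [IsOrderedAddMonoid X] [IsOrderedModule ℝ X] {n : ℕ}
    (x : Fin n → X) : ∃ τ : HomFun n →ₗ[ℝ] X, IsKrivine x τ := by
  obtain ⟨K, hK, hb⟩ := krivineGraph_bound x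
  let G := (krivineGraph x).topologicalClosure
  have hGb : ∀ p ∈ G, ‖p.2‖ ≤ K * ‖p.1‖ := by
    have hcl : IsClosed {p : C(CubeSphere n, ℝ) × X | ‖p.2‖ ≤ K * ‖p.1‖} :=
      isClosed_le continuous_snd.norm (continuous_const.mul continuous_fst.norm)
    exact fun p hp => closure_minimal (fun q hq => hb q hq) hcl hp
  have hsc : Continuous fun p : (C(CubeSphere n, ℝ) × X) × (C(CubeSphere n, ℝ) × X) =>
      p.1 ⊔ p.2 := by
    have h1 : Continuous fun p : C(CubeSphere n, ℝ) × C(CubeSphere n, ℝ) => p.1 ⊔ p.2 := by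
      refine ContinuousMap.continuous_of_continuous_uncurry _ ?_
      exact (ContinuousEval.continuous_eval.comp ((continuous_fst.comp continuous_fst).prodMk
        continuous_snd)).max (ContinuousEval.continuous_eval.comp
        ((continuous_snd.comp continuous_fst).prodMk continuous_snd))
    exact (h1.comp ((continuous_fst.comp continuous_fst).prodMk
      (continuous_fst.comp continuous_snd))).prodMk
      ((continuous_snd.comp continuous_fst).sup (continuous_snd.comp continuous_snd))
  have hGs : ∀ p ∈ G, ∀ q ∈ G, p ⊔ q ∈ G := fun p hp q hq =>
    map_mem_closure₂ hsc hp hq fun a ha b hb => krivineGraph_sup x ha hb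
  let F : G →ₗ[ℝ] C(CubeSphere n, ℝ) := (LinearMap.fst ℝ _ _).comp G.subtype
  have hFanti : AntilipschitzWith (max 1 K.toNNReal) F := by
    refine AddMonoidHomClass.antilipschitz_of_bound F fun p => ?_
    have h1 := hGb p.1 p.2
    have : ‖p‖ = max ‖p.1.1‖ ‖p.1.2‖ := rfl
    refine this.le.trans ?_
    have h2 : (1 : ℝ) ≤ max 1 K := le_max_left _ _
    have h3 : K ≤ max 1 K := le_max_right _ _
    have e : ((max 1 K.toNNReal : NNReal) : ℝ) = max 1 K := by simp [hK]
    rw [e]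
    change max ‖p.1.1‖ ‖p.1.2‖ ≤ max 1 K * ‖p.1.1‖
    refine max_le ?_ (h1.trans ?_)
    · nlinarith [norm_nonneg p.1.1]
    · exact mul_le_mul_of_nonneg_right h3 (norm_nonneg _)
  have hFc : UniformContinuous F := uniformContinuous_fst.comp uniformContinuous_subtype_val
  have hGc : IsClosed (G : Set (C(CubeSphere n, ℝ) × X)) :=
    (krivineGraph x).isClosed_topologicalClosure
  have : CompleteSpace G := hGc.completeSpace_coe
  have hFr : range F = univ := by
    rw [← (hFanti.isClosed_range hFc).closure_eq, ← univ_subset_iff, ← krivineGraph_dense x]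
    refine closure_mono ?_
    rintro _ ⟨p, hp, rfl⟩
    exact ⟨⟨p, subset_closure hp⟩, rfl⟩
  let e : G ≃ₗ[ℝ] C(CubeSphere n, ℝ) :=
    LinearEquiv.ofBijective F ⟨hFanti.injective, range_eq_univ.1 hFr⟩
  have he : ∀ p (hp : p ∈ G), e.symm p.1 = ⟨p, hp⟩ := fun p hp => by
    rw [LinearEquiv.symm_apply_eq]; rfl
  have he1 : ∀ f, (e.symm f).1.1 = f := fun f => e.apply_symm_apply f
  refine ⟨(LinearMap.snd ℝ _ _).comp (G.subtype.comp (e.symm.toLinearMap.comp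
    (HomFun.restrict n))), ?_, ?_⟩
  · intro j
    have := he _ (subset_closure (krivineGraph_proj x j))
    change (e.symm (sphereProj j)).1.2 = x j
    rw [this]
  · intro h₁ h₂
    have := he _ (hGs _ (e.symm (HomFun.restrict n h₁)).2 _ (e.symm (HomFun.restrict n h₂)).2)
    rw [Prod.fst_sup, he1, he1] at this
    change (e.symm (HomFun.restrict n h₁ ⊔ HomFun.restrict n h₂)).1.2 = _
    rw [this]
    rfl

theorem IsKrivine.mono {X : Type*} [AddCommGroup X] [Module ℝ X] [Lattice X]
    {n : ℕ} {x : Fin n → X} {τ : HomFun n →ₗ[ℝ] X} (hτ : IsKrivine x τ) {h₁ h₂ : HomFun n}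
    (h : ∀ t, h₁.1 t ≤ h₂.1 t) : τ h₁ ≤ τ h₂ := by
  have : HomFun.sup h₁ h₂ = h₂ := Subtype.ext (funext fun t => max_eq_right (h t))
  rw [← sup_eq_right, ← hτ.map_sup, this]

theorem IsKrivine.norm_le {X : Type*} [NormedAddCommGroup X] [NormedSpace ℝ X]
    [Lattice X] [HasSolidNorm X] [IsOrderedAddMonoid X] {n : ℕ}
    {x : Fin n → X} {τ : HomFun n →ₗ[ℝ] X} (hτ : IsKrivine x τ) (h : HomFun n) :
    ‖τ h‖ ≤ ‖HomFun.restrict n h‖ * ‖τ (HomFun.supNorm n)‖ := by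
  have hb : ∀ t, |h.1 t| ≤ ‖HomFun.restrict n h‖ * ‖t‖ := by
    intro t
    rcases eq_or_ne t 0 with rfl | ht
    · have := h.2.2 0 le_rfl 0
      simp only [zero_smul, zero_mul] at this
      simp [this]
    · have htn : 0 < ‖t‖ := norm_pos_iff.2 ht
      have hs := (HomFun.restrict n h).norm_coe_le_norm
        ⟨‖t‖⁻¹ • t, by simp [norm_smul, htn.ne']⟩
      have e := h.2.2 ‖t‖ htn.le (‖t‖⁻¹ • t)
      rw [smul_smul, mul_inv_cancel₀ htn.ne', one_smul] at e
      rw [e, abs_mul, abs_of_pos htn, mul_comm]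
      exact mul_le_mul_of_nonneg_right hs htn.le
  set c := ‖HomFun.restrict n h‖ with hc
  have i1 : τ h ≤ τ (c • HomFun.supNorm n) := hτ.mono fun t => (abs_le'.1 (hb t)).1
  have i2 : τ (-h) ≤ τ (c • HomFun.supNorm n) := hτ.mono fun t => (abs_le'.1 (hb t)).2
  rw [map_neg] at i2
  have i3 : |τ h| ≤ |τ (c • HomFun.supNorm n)| := (abs_le'.2 ⟨i1, i2⟩).trans (le_abs_self _)
  refine (norm_le_norm_of_abs_le_abs i3).trans ?_
  rw [map_smul, norm_smul, Real.norm_of_nonneg (norm_nonneg _)]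

theorem IsKrivine.unique {X : Type*} [NormedAddCommGroup X] [NormedSpace ℝ X]
    [Lattice X] [HasSolidNorm X] [IsOrderedAddMonoid X] [IsOrderedModule ℝ X] {n : ℕ}
    {x : Fin n → X} {τ σ : HomFun n →ₗ[ℝ] X} (hτ : IsKrivine x τ) (hσ : IsKrivine x σ) :
    τ = σ := by
  have hlin : ∀ a : Fin n → ℝ, ∃ h : HomFun n, (∀ t, h.1 t = ∑ j, a j • t j) ∧
      τ h = ∑ j, a j • x j ∧ σ h = ∑ j, a j • x j := fun a =>
    ⟨∑ j, a j • HomFun.proj j, fun t => by simp [HomFun.proj], by simp [hτ.map_proj],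
      by simp [hσ.map_proj]⟩
  have hsup : ∀ (A : Finset (Fin n → ℝ)) (hA : A.Nonempty), ∃ h : HomFun n,
      (∀ t, h.1 t = supLin A hA t) ∧ τ h = σ h := by
    intro A hA
    induction hA using Finset.Nonempty.cons_induction with
    | singleton a =>
      obtain ⟨h, h1, h2, h3⟩ := hlin a
      exact ⟨h, fun t => by rw [h1, supLin_singleton], h2.trans h3.symm⟩
    | cons a s ha hs ih =>
      obtain ⟨h, h1, h2, h3⟩ := hlin a
      obtain ⟨g, g1, g2⟩ := ih
      refine ⟨HomFun.sup h g, fun t => ?_, ?_⟩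
      · change max (h.1 t) (g.1 t) = _
        rw [h1, g1, supLin, supLin, Finset.sup'_cons hs]
      · rw [hτ.map_sup, hσ.map_sup, h2, h3, g2]
  have hdiff : ∀ f ∈ Prod.fst '' (krivineGraph x : Set (C(CubeSphere n, ℝ) × X)),
      ∃ h : HomFun n, HomFun.restrict n h = f ∧ τ h = σ h := by
    rintro _ ⟨p, ⟨A, B, hA, hB, h1, -⟩, rfl⟩
    obtain ⟨g, g1, g2⟩ := hsup A hA
    obtain ⟨k, k1, k2⟩ := hsup B hB
    refine ⟨g - k, ?_, by rw [map_sub, map_sub, g2, k2]⟩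
    ext s
    rw [h1, ← g1, ← k1]
    rfl
  refine LinearMap.ext fun h => eq_of_forall_dist_le fun ε hε => ?_
  set M := ‖τ (HomFun.supNorm n)‖ + ‖σ (HomFun.supNorm n)‖ + 1 with hM
  have hMp : 0 < M := by positivity
  have hcl : HomFun.restrict n h ∈
      closure (Prod.fst '' (krivineGraph x : Set (C(CubeSphere n, ℝ) × X))) := by
    rw [krivineGraph_dense]; trivial
  obtain ⟨f, hf, hd⟩ := Metric.mem_closure_iff.1 hcl (ε / M) (by positivity)
  obtain ⟨g, rfl, hg⟩ := hdiff f hf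
  rw [dist_eq_norm, ← map_sub] at hd
  have e : τ h - σ h = τ (h - g) - σ (h - g) := by
    rw [map_sub, map_sub, hg]; abel
  rw [dist_eq_norm, e]
  have h1 := hτ.norm_le (h - g)
  have h2 := hσ.norm_le (h - g)
  have h3 := norm_sub_le (τ (h - g)) (σ (h - g))
  have h4 : ‖HomFun.restrict n (h - g)‖ * M ≤ ε := by
    rw [← le_div_iff₀ hMp]; exact hd.le
  have h5 := norm_nonneg (HomFun.restrict n (h - g))
  nlinarith

/-- Krivine's theorem: the functional calculus exists and is unique. -/
theorem IsKrivine.existsUnique {X : Type*} [NormedAddCommGroup X] [NormedSpace ℝ X]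
    [CompleteSpace X] [Lattice X] [HasSolidNorm X] [IsOrderedAddMonoid X] [IsOrderedModule ℝ X]
    {n : ℕ} (x : Fin n → X) : ∃! τ : HomFun n →ₗ[ℝ] X, IsKrivine x τ :=
  let ⟨τ, hτ⟩ := IsKrivine.exists x
  ⟨τ, hτ, fun _ hσ => hσ.unique hτ⟩

/-- Krivine's functional calculus `τ_{n,x} : 𝓗_n → X` at `x = (x₁, …, xₙ)`. -/
noncomputable def krivine {X : Type*} [NormedAddCommGroup X] [NormedSpace ℝ X]
    [CompleteSpace X] [Lattice X] [HasSolidNorm X] [IsOrderedAddMonoid X] [IsOrderedModule ℝ X]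
    {n : ℕ} (x : Fin n → X) : HomFun n →ₗ[ℝ] X :=
  (IsKrivine.existsUnique x).choose

theorem krivine_spec {X : Type*} [NormedAddCommGroup X] [NormedSpace ℝ X]
    [CompleteSpace X] [Lattice X] [HasSolidNorm X] [IsOrderedAddMonoid X] [IsOrderedModule ℝ X]
    {n : ℕ} (x : Fin n → X) : IsKrivine x (krivine x) :=
  (IsKrivine.existsUnique x).choose_spec.1

/-! ### Banach sequence lattices, convexity and concavity -/

/-- A Banach sequence lattice: a vector space `Y` of real sequences, containing the canonical
sequences `e_k`, with a complete norm, such that `|f| ≤ |g|` pointwise and `g ∈ Y` imply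
`f ∈ Y` and `‖f‖ ≤ ‖g‖`. -/
structure BanachSeqLattice where
  carrier : Submodule ℝ (ℕ → ℝ)
  norm : Seminorm ℝ carrier
  eq_zero_of_norm : ∀ f, norm f = 0 → f = 0
  solid : ∀ (f : ℕ → ℝ) (g : carrier), (∀ k, |f k| ≤ |g.1 k|) →
    ∃ hf : f ∈ carrier, norm ⟨f, hf⟩ ≤ norm g
  complete : ∀ u : ℕ → carrier,
    (∀ ε : ℝ, 0 < ε → ∃ N, ∀ k ≥ N, ∀ m ≥ N, norm (u k - u m) < ε) →
      ∃ f : carrier, Tendsto (fun k => norm (u k - f)) atTop (𝓝 0)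
  single_mem : ∀ k : ℕ, (Pi.single k 1 : ℕ → ℝ) ∈ carrier

namespace BanachSeqLattice

/-- The finite sequence `(t₁, …, tₙ)` viewed as `(t₁, …, tₙ, 0, 0, …)`. -/
def extend (n : ℕ) : (Fin n → ℝ) →ₗ[ℝ] (ℕ → ℝ) where
  toFun t k := if h : k < n then t ⟨k, h⟩ else 0
  map_add' s t := by funext k; by_cases h : k < n <;> simp [h]
  map_smul' c t := by funext k; by_cases h : k < n <;> simp [h]

theorem extend_mem (Y : BanachSeqLattice) (n : ℕ) (t : Fin n → ℝ) : extend n t ∈ Y.carrier := by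
  have : extend n t = ∑ j : Fin n, t j • (Pi.single (j : ℕ) 1 : ℕ → ℝ) := by
    funext k
    by_cases h : k < n
    · rw [Finset.sum_apply, Finset.sum_eq_single ⟨k, h⟩]
      · simp [extend, h]
      · intro b _ hb
        have : k ≠ b := fun e => hb (Fin.ext e.symm)
        simp [this]
      · simp
    · have : ∀ j : Fin n, k ≠ j := fun j e => h (e ▸ j.2)
      simp [extend, h, this]
  rw [this]
  exact Submodule.sum_mem _ fun j _ => Y.carrier.smul_mem _ (Y.single_mem _)

/-- The norm `‖·‖_{ℝⁿ,Y}` on `ℝⁿ`. -/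
def normRn (Y : BanachSeqLattice) (n : ℕ) : Seminorm ℝ (Fin n → ℝ) :=
  Y.norm.comp ((extend n).codRestrict Y.carrier (Y.extend_mem n))

theorem continuous_normRn (Y : BanachSeqLattice) (n : ℕ) : Continuous (Y.normRn n) := by
  have hC : 0 ≤ ∑ j, Y.normRn n (Pi.single j 1) := Finset.sum_nonneg fun j _ => apply_nonneg _ _
  have hle : ∀ t, Y.normRn n t ≤ (∑ j, Y.normRn n (Pi.single j 1)) * ‖t‖ := by
    intro t
    conv_lhs => rw [pi_eq_sum_univ' t]
    refine (Finset.le_sum_of_subadditive _ (map_zero _).le (map_add_le_add _) _ _).trans ?_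
    rw [Finset.sum_mul]
    refine Finset.sum_le_sum fun j _ => ?_
    rw [map_smul_eq_mul, mul_comm]
    exact mul_le_mul_of_nonneg_left (norm_le_pi_norm t j) (apply_nonneg _ _)
  refine Seminorm.continuous_of_le (q := (Real.toNNReal (∑ j, Y.normRn n (Pi.single j 1))) • normSeminorm ℝ (Fin n → ℝ)) ?_ fun t => ?_
  · exact continuous_const.mul continuous_norm
  · change _ ≤ ((Real.toNNReal (∑ j, Y.normRn n (Pi.single j 1)) : NNReal) : ℝ) * ‖t‖
    rw [Real.coe_toNNReal _ hC]
    exact hle t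

/-- The norm `‖·‖_{ℝⁿ,Y}` as an element of `𝓗_n`. -/
def normHom (Y : BanachSeqLattice) (n : ℕ) : HomFun n :=
  ⟨Y.normRn n, Y.continuous_normRn n, fun c hc t => by
    rw [map_smul_eq_mul, Real.norm_of_nonneg hc]⟩

/-- `‖(w₁, …, wₙ)‖_{Eⁿ,Y} = ‖(‖w₁‖, …, ‖wₙ‖)‖_Y`. -/
def normPow (Y : BanachSeqLattice) {E : Type*} [NormedAddCommGroup E] {n : ℕ} (w : Fin n → E) :
    ℝ :=
  Y.normRn n fun j => ‖w j‖

/-- `‖(x₁, …, xₙ)‖_{Xⁿ,Y,τ}`: the norm in `X` of the element `‖(x₁, …, xₙ)‖_Y` of `X` that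
Krivine's functional calculus assigns to the norm `‖·‖_{ℝⁿ,Y}`. -/
noncomputable def normTau (Y : BanachSeqLattice) {X : Type*} [NormedAddCommGroup X]
    [NormedSpace ℝ X] [CompleteSpace X] [Lattice X] [HasSolidNorm X] [IsOrderedAddMonoid X]
    [IsOrderedModule ℝ X] {n : ℕ} (x : Fin n → X) : ℝ :=
  ‖krivine x (Y.normHom n)‖

/-- The linear operator `T : E → X` into a Banach lattice is `Y`-convex. -/
def IsConvex (Y : BanachSeqLattice) {E X : Type*} [NormedAddCommGroup E] [NormedSpace ℝ E]
    [NormedAddCommGroup X] [NormedSpace ℝ X] [CompleteSpace X] [Lattice X] [HasSolidNorm X]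
    [IsOrderedAddMonoid X] [IsOrderedModule ℝ X] (T : E →ₗ[ℝ] X) : Prop :=
  ∃ C : ℝ, 0 < C ∧ ∀ (n : ℕ) (w : Fin n → E), Y.normTau (fun j => T (w j)) ≤ C * Y.normPow w

/-- The linear operator `S : X → E` on a Banach lattice is `Y`-concave. -/
def IsConcave (Y : BanachSeqLattice) {E X : Type*} [NormedAddCommGroup E] [NormedSpace ℝ E]
    [NormedAddCommGroup X] [NormedSpace ℝ X] [CompleteSpace X] [Lattice X] [HasSolidNorm X]
    [IsOrderedAddMonoid X] [IsOrderedModule ℝ X] (S : X →ₗ[ℝ] E) : Prop :=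
  ∃ K : ℝ, 0 < K ∧ ∀ (n : ℕ) (x : Fin n → X), Y.normPow (fun j => S (x j)) ≤ K * Y.normTau x

/-- A Banach lattice is `Y`-convex if its identity operator is. -/
def IsConvexLattice (Y : BanachSeqLattice) (X : Type*) [NormedAddCommGroup X] [NormedSpace ℝ X]
    [CompleteSpace X] [Lattice X] [HasSolidNorm X] [IsOrderedAddMonoid X]
    [IsOrderedModule ℝ X] : Prop :=
  Y.IsConvex (LinearMap.id : X →ₗ[ℝ] X)

/-- A Banach lattice is `Y`-concave if its identity operator is. -/
def IsConcaveLattice (Y : BanachSeqLattice) (X : Type*) [NormedAddCommGroup X] [NormedSpace ℝ X]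
    [CompleteSpace X] [Lattice X] [HasSolidNorm X] [IsOrderedAddMonoid X]
    [IsOrderedModule ℝ X] : Prop :=
  Y.IsConcave (LinearMap.id : X →ₗ[ℝ] X)

end BanachSeqLattice

/-- `H` preserves the lattice operations. Since `H` is a linear bijection that is continuous in
both directions, this makes it a lattice isomorphism; preservation of `∧` follows from
`x ∧ y = -((-x) ∨ (-y))`. -/
def IsLatticeIso {X W : Type*} [NormedAddCommGroup X] [NormedSpace ℝ X] [Lattice X]
    [NormedAddCommGroup W] [NormedSpace ℝ W] [Lattice W] (H : X ≃L[ℝ] W) : Prop :=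
  ∀ x y, H (x ⊔ y) = H x ⊔ H y

end YConvexity

namespace YConvexity

section LatticeIso

variable {X W : Type*}
  [NormedAddCommGroup X] [NormedSpace ℝ X] [Lattice X]
  [NormedAddCommGroup W] [NormedSpace ℝ W] [Lattice W]

/-! Everything rests on the uniqueness of Krivine's functional calculus. If `H` is a lattice
isomorphism and `τ` is the calculus at `x`, then `H ∘ τ` is linear, sends the coordinate projections
to `H (x j)` and preserves binary suprema, so it is the calculus at `(H (x j))ⱼ` (`IsKrivine.map`,
`krivine_map`). Evaluating at `Y.normHom n` and taking norms gives `normTau (H x) ≤ ‖H‖ * normTau x`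
(`normTau_map_le`).

Hence `Y`-convexity survives composition with `H` on the left, and `Y`-concavity composition with
`H` on the right. The converses are the same statements applied to `H.symm`, which cancels `H`.

For the lattices themselves one writes `id_W = H ∘ id_X ∘ H⁻¹`. One of the two outer factors acts on
the Krivine side and is handled as above. The other acts on the side where only the norms of the
vectors enter; there boundedness is enough, because `‖·‖_Y` is monotone (`normPow_map_le`). -/

/-! ### Transport of the functional calculus along lattice isomorphisms -/

theorem IsLatticeIso.symm {H : X ≃L[ℝ] W} (hH : IsLatticeIso H) : IsLatticeIso H.symm := by
  intro x y
  apply H.injective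
  rw [hH]
  simp

/-- Both defining properties of the calculus are identities in `X`, and `H` carries them to `W`.
Only linearity and preservation of suprema matter here; continuity of `H` enters with the norm
estimates. -/
theorem IsKrivine.map {H : X ≃L[ℝ] W} (hH : IsLatticeIso H) {n : ℕ} {x : Fin n → X}
    {τ : HomFun n →ₗ[ℝ] X} (hτ : IsKrivine x τ) :
    IsKrivine (fun j => H (x j)) (H.toLinearMap ∘ₗ τ) where
  map_proj j := congrArg H (hτ.map_proj j)
  map_sup h₁ h₂ := (congrArg H (hτ.map_sup h₁ h₂)).trans (hH _ _)

variable [CompleteSpace X] [HasSolidNorm X] [IsOrderedAddMonoid X] [IsOrderedModule ℝ X]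
  [CompleteSpace W] [HasSolidNorm W] [IsOrderedAddMonoid W] [IsOrderedModule ℝ W]

/-- Krivine's functional calculus commutes with lattice isomorphisms. -/
theorem krivine_map {H : X ≃L[ℝ] W} (hH : IsLatticeIso H) {n : ℕ} (x : Fin n → X)
    (h : HomFun n) : krivine (fun j => H (x j)) h = H (krivine x h) :=
  LinearMap.congr_fun ((krivine_spec _).unique ((krivine_spec x).map hH)) h

namespace BanachSeqLattice

/-! ### Norm estimates for images of tuples -/

theorem normTau_map_le (Y : BanachSeqLattice) {H : X ≃L[ℝ] W} (hH : IsLatticeIso H) {n : ℕ}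
    (x : Fin n → X) :
    Y.normTau (fun j => H (x j)) ≤ ‖(H : X →L[ℝ] W)‖ * Y.normTau x := by
  rw [normTau, krivine_map hH]
  exact (H : X →L[ℝ] W).le_opNorm _

theorem normTau_nonneg (Y : BanachSeqLattice) {n : ℕ} (x : Fin n → X) : 0 ≤ Y.normTau x :=
  norm_nonneg _

/-- This is solidity of `Y`, applied to the extensions by zero. -/
theorem normRn_mono (Y : BanachSeqLattice) {n : ℕ} {s t : Fin n → ℝ} (h : ∀ j, |s j| ≤ |t j|) :
    Y.normRn n s ≤ Y.normRn n t := by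
  obtain ⟨_, hle⟩ := Y.solid (extend n s) ⟨extend n t, Y.extend_mem n t⟩ fun k => by
    by_cases hk : k < n
    · simpa [extend, hk] using h ⟨k, hk⟩
    -- Beyond the first `n` places both extended sequences vanish.
    · simp [extend, hk]
  exact hle

theorem normPow_nonneg (Y : BanachSeqLattice) {E : Type*} [NormedAddCommGroup E] {n : ℕ}
    (w : Fin n → E) : 0 ≤ Y.normPow w :=
  apply_nonneg _ _

variable {E F : Type*} [NormedAddCommGroup E] [NormedSpace ℝ E]
  [NormedAddCommGroup F] [NormedSpace ℝ F]

/-- The coordinatewise bound `‖A (w j)‖ ≤ ‖A‖ * ‖w j‖` passes through the monotone, homogeneous norm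
of `Y`. No lattice structure on `E` or `F` is involved. -/
theorem normPow_map_le (Y : BanachSeqLattice) (A : E →L[ℝ] F) {n : ℕ} (w : Fin n → E) :
    Y.normPow (fun j => A (w j)) ≤ ‖A‖ * Y.normPow w := by
  have h : Y.normRn n (fun j => ‖A (w j)‖) ≤ Y.normRn n (‖A‖ • fun j => ‖w j‖) := by
    refine Y.normRn_mono fun j => ?_
    rw [abs_of_nonneg (norm_nonneg _)]
    exact (A.le_opNorm _).trans (le_abs_self _)
  rwa [map_smul_eq_mul, norm_norm] at h

variable {Y : BanachSeqLattice}

/-! ### Stability of convexity and concavity under composition -/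

theorem IsConvex.latticeIso_comp {T : E →ₗ[ℝ] X} (hT : Y.IsConvex T) {H : X ≃L[ℝ] W}
    (hH : IsLatticeIso H) : Y.IsConvex (H.toLinearMap ∘ₗ T) := by
  obtain ⟨C, hC, h⟩ := hT
  -- The constant must be strictly positive, whereas `‖H‖` is zero when the spaces are trivial;
  -- hence the `+ 1`, here and in the three lemmas that follow.
  refine ⟨(‖(H : X →L[ℝ] W)‖ + 1) * C, by positivity, fun n w => ?_⟩
  calc Y.normTau (fun j => H (T (w j)))
      ≤ ‖(H : X →L[ℝ] W)‖ * Y.normTau (fun j => T (w j)) := Y.normTau_map_le hH _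
    _ ≤ (‖(H : X →L[ℝ] W)‖ + 1) * (C * Y.normPow w) :=
        mul_le_mul (by linarith) (h n w) (Y.normTau_nonneg _) (by positivity)
    _ = _ := by ring

/-- The inner factor only changes the norms on the right-hand side of the convexity inequality, so
it need not respect any order. -/
theorem IsConvex.comp_continuousLinearMap {T : E →ₗ[ℝ] X} (hT : Y.IsConvex T) (A : F →L[ℝ] E) :
    Y.IsConvex (T ∘ₗ A.toLinearMap) := by
  obtain ⟨C, hC, h⟩ := hT
  refine ⟨C * (‖A‖ + 1), by positivity, fun n w => ?_⟩
  calc Y.normTau (fun j => T (A (w j)))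
      ≤ C * Y.normPow (fun j => A (w j)) := h n _
    _ ≤ C * ((‖A‖ + 1) * Y.normPow w) := by
        refine mul_le_mul_of_nonneg_left ((Y.normPow_map_le A w).trans ?_) hC.le
        exact mul_le_mul_of_nonneg_right (by linarith) (Y.normPow_nonneg w)
    _ = _ := by ring

theorem IsConcave.comp_latticeIso {S : X →ₗ[ℝ] E} (hS : Y.IsConcave S) {H : W ≃L[ℝ] X}
    (hH : IsLatticeIso H) : Y.IsConcave (S ∘ₗ H.toLinearMap) := by
  obtain ⟨K, hK, h⟩ := hS
  refine ⟨K * (‖(H : W →L[ℝ] X)‖ + 1), by positivity, fun n x => ?_⟩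
  calc Y.normPow (fun j => S (H (x j)))
      ≤ K * Y.normTau (fun j => H (x j)) := h n _
    _ ≤ K * ((‖(H : W →L[ℝ] X)‖ + 1) * Y.normTau x) := by
        refine mul_le_mul_of_nonneg_left ((Y.normTau_map_le hH x).trans ?_) hK.le
        exact mul_le_mul_of_nonneg_right (by linarith) (Y.normTau_nonneg x)
    _ = _ := by ring

/-- Dual situation: the outer factor only meets the norms on the left-hand side of the concavity
inequality. -/
theorem IsConcave.continuousLinearMap_comp {S : X →ₗ[ℝ] E} (hS : Y.IsConcave S) (A : E →L[ℝ] F) :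
    Y.IsConcave (A.toLinearMap ∘ₗ S) := by
  obtain ⟨K, hK, h⟩ := hS
  refine ⟨(‖A‖ + 1) * K, by positivity, fun n x => ?_⟩
  calc Y.normPow (fun j => A (S (x j)))
      ≤ ‖A‖ * Y.normPow (fun j => S (x j)) := Y.normPow_map_le A _
    _ ≤ (‖A‖ + 1) * (K * Y.normTau x) :=
        mul_le_mul (by linarith) (h n x) (Y.normPow_nonneg _) (by positivity)
    _ = _ := by ring

/-! ### Invariance under lattice isomorphisms -/

theorem isConvex_latticeIso_comp_iff {H : X ≃L[ℝ] W} (hH : IsLatticeIso H) {T : E →ₗ[ℝ] X} :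
    Y.IsConvex (H.toLinearMap ∘ₗ T) ↔ Y.IsConvex T := by
  refine ⟨fun h => ?_, fun h => h.latticeIso_comp hH⟩
  -- `T = H⁻¹ ∘ (H ∘ T)`.
  convert h.latticeIso_comp hH.symm using 1
  ext w
  exact (H.symm_apply_apply _).symm

theorem isConcave_comp_latticeIso_iff {H : W ≃L[ℝ] X} (hH : IsLatticeIso H) {S : X →ₗ[ℝ] E} :
    Y.IsConcave (S ∘ₗ H.toLinearMap) ↔ Y.IsConcave S := by
  refine ⟨fun h => ?_, fun h => h.comp_latticeIso hH⟩
  -- `S = (S ∘ H) ∘ H⁻¹`.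
  convert h.comp_latticeIso hH.symm using 1
  ext x
  exact congrArg S (H.apply_symm_apply x).symm

theorem IsConvexLattice.of_latticeIso (hX : Y.IsConvexLattice X) {H : X ≃L[ℝ] W}
    (hH : IsLatticeIso H) : Y.IsConvexLattice W := by
  unfold IsConvexLattice at hX ⊢
  -- `id_W = H ∘ (id_X ∘ H⁻¹)`: here `H⁻¹` serves merely as a bounded operator, while `H` acts as a
  -- lattice isomorphism.
  convert (hX.comp_continuousLinearMap (H.symm : W →L[ℝ] X)).latticeIso_comp hH using 1
  ext w
  exact (H.apply_symm_apply w).symm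

theorem IsConcaveLattice.of_latticeIso (hX : Y.IsConcaveLattice X) {H : X ≃L[ℝ] W}
    (hH : IsLatticeIso H) : Y.IsConcaveLattice W := by
  unfold IsConcaveLattice at hX ⊢
  -- `id_W = (H ∘ id_X) ∘ H⁻¹`: the roles are exchanged, with `H` merely bounded and `H⁻¹` moving
  -- the calculus.
  convert (hX.continuousLinearMap_comp (H : X →L[ℝ] W)).comp_latticeIso hH.symm using 1
  ext w
  exact (H.apply_symm_apply w).symm

end BanachSeqLattice

end LatticeIso

end YConvexity

theorem mainTheorem8 {E X W : Type*}
    [NormedAddCommGroup E] [NormedSpace ℝ E] [CompleteSpace E]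
    [NormedAddCommGroup X] [NormedSpace ℝ X] [CompleteSpace X] [Lattice X] [HasSolidNorm X]
    [IsOrderedAddMonoid X] [IsOrderedModule ℝ X]
    [NormedAddCommGroup W] [NormedSpace ℝ W] [CompleteSpace W] [Lattice W] [HasSolidNorm W]
    [IsOrderedAddMonoid W] [IsOrderedModule ℝ W]
    (Y : YConvexity.BanachSeqLattice) :
    (∀ H₁ : X ≃L[ℝ] W, YConvexity.IsLatticeIso H₁ → ∀ T : E →L[ℝ] X,
      (Y.IsConvex (H₁.toLinearMap ∘ₗ T.toLinearMap) ↔ Y.IsConvex T.toLinearMap)) ∧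
    (∀ H₂ : W ≃L[ℝ] X, YConvexity.IsLatticeIso H₂ → ∀ S : X →L[ℝ] E,
      (Y.IsConcave (S.toLinearMap ∘ₗ H₂.toLinearMap) ↔ Y.IsConcave S.toLinearMap)) ∧
    (∀ H : X ≃L[ℝ] W, YConvexity.IsLatticeIso H →
      (Y.IsConvexLattice X ↔ Y.IsConvexLattice W) ∧
      (Y.IsConcaveLattice X ↔ Y.IsConcaveLattice W)) := by
  refine ⟨fun H₁ h T => ?_, fun H₂ h S => ?_,
    fun H h => ⟨⟨fun hX => ?_, fun hW => ?_⟩, ⟨fun hX => ?_, fun hW => ?_⟩⟩⟩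
  · exact YConvexity.BanachSeqLattice.isConvex_latticeIso_comp_iff h
  · exact YConvexity.BanachSeqLattice.isConcave_comp_latticeIso_iff h
  · exact hX.of_latticeIso h
  · exact hW.of_latticeIso h.symm
  · exact hX.of_latticeIso h
  · exact hW.of_latticeIso h.symm
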